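/- \textbf{Setting.} Let $t\ge 2$, let $\mathcal X$ be a finite set, let $X$ be an $\mathcal X$-valued random variable, and let $q$ be the law on $\mathcal X^t$ of $(X_1,\dots,X_t)$ with $X_1=\dots=X_t=X$. Let $H(X)=-\sum_x \Pr(X=x)\log_2\Pr(X=x)$. Write $[1:a]$ for the set of positive integers that are at most $a$. In the \emph{randomness-on-the-forehead model} there are independent random variables $W_1,\dots,W_t$, where $W_j$ is uniform on $[1:2^{nR_j}]$. A coordinator observes $W_1,\dots,W_t$ and produces a message $M\in[1:2^{nR}]$ according to a conditional p.m.f. $p(m|w_1,\dots,w_t)$. Processor $i\in[1:t]$ observes $M$ and all $W_j$ with $j\neq i$, and produces $X_i^n\in\mathcal X^n$ according to a conditional p.m.f. $p(x_i^n|m,(w_j)_{j\ne i})$. Such a choice of conditional p.m.f.s is an $(n,2^{nR},2^{nR_1},\dots,2^{nR_t})$ \emph{simulation code}; the law of the outputs that it induces is $$p(x_1^n,\dots,x_t^n)=\sum_{w_1,\dots,w_t,m}\Big(\prod_{j=1}^t \big|[1:2^{nR_j}]\big|^{-1}\Big)\,p(m|w_1,\dots,w_t)\prod_{i=1}^t p\big(x_i^n|m,(w_j)_{j\neq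 i}\big).$$ A tuple $(R,R_1,\dots,R_t)$ of non-negative reals is \emph{achievable} for $q$ if there is a sequence of $(n,2^{nR},2^{nR_1},\dots,2^{nR_t})$ simulation codes whose induced output laws $p^{(n)}$ satisfy $\lim_{n\to\infty}\|p^{(n)}-q^{(n)}\|_1=0$, where $q^{(n)}(x_1^n,\dots,x_t^n)=\prod_{k=1}^n q(x_{1k},\dots,x_{tk})$. The \emph{simulation rate region} $\mathcal R^{\mathrm{Forehead}}$ is the closure in $\mathbb R^{t+1}$ of the set of achievable tuples. \textbf{Theorem.} $\mathcal R^{\mathrm{Forehead}}$ is the set of all tuples $(R,R_1,\dots,R_t)$ of non-negative reals such that $$iR+\sum_{j\in\mathcal S}R_j\ \ge\ H(X)\qquad\text{for all } i\in[1:t] \text{ and all } \mathcal S\subsetneq[1:t] \text{ with } |\mathcal S|=t-i.$$ -/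

import Mathlib

noncomputable section

/-- The number of elements of the index set `[1 : 2 ^ (n r)]`, that is, the number of
positive integers that are at most `2 ^ (n r)`. -/
def indexCount (n : ℕ) (r : ℝ) : ℕ := ⌊(2 : ℝ) ^ ((n : ℝ) * r)⌋₊

/-- An `(n, 2^{nR}, 2^{nR_1}, …, 2^{nR_h})` simulation code for the omniscient coordinator setting
with `t` processors and `h` independent sources of shared randomness, where processor `i` observes
the sources `W_j`, `j ∈ V i`.  The coordinator sees all the sources and randomizes privately to
produce the message; processor `i` randomizes privately, given the message and the sources that it
observes, to produce a word of length `n` over its alphabet `𝒳 i`. -/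
structure SimulationCode {t h : ℕ} (V : Fin t → Finset (Fin h)) (𝒳 : Fin t → Type*)
    (n : ℕ) (R : ℝ) (Rs : Fin h → ℝ) where
  /-- `p(m | w_1, …, w_h)` -/
  encoder : (∀ j : Fin h, Fin (indexCount n (Rs j))) → PMF (Fin (indexCount n R))
  /-- `p(x_i^n | m, w_{V_i})` -/
  decoder : ∀ i : Fin t, Fin (indexCount n R) →
    (∀ j : {j : Fin h // j ∈ V i}, Fin (indexCount n (Rs j.1))) → PMF (Fin n → 𝒳 i)

/-- The joint law of `(W_1, …, W_h, M, X_1^n, …, X_t^n)`: the sources are independent, `W_j` being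
uniform on its index set. -/
def SimulationCode.joint {t h : ℕ} {V : Fin t → Finset (Fin h)} {𝒳 : Fin t → Type*}
    {n : ℕ} {R : ℝ} {Rs : Fin h → ℝ} (c : SimulationCode V 𝒳 n R Rs)
    (w : ∀ j : Fin h, Fin (indexCount n (Rs j))) (m : Fin (indexCount n R))
    (x : ∀ i : Fin t, Fin n → 𝒳 i) : ℝ :=
  (∏ j : Fin h, ((indexCount n (Rs j) : ℝ))⁻¹) * (c.encoder w m).toReal *
    ∏ i : Fin t, (c.decoder i m (fun j => w j.1) (x i)).toReal

/-- The law of the outputs `(X_1^n, …, X_t^n)` induced by a simulation code. -/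
def SimulationCode.induced {t h : ℕ} {V : Fin t → Finset (Fin h)} {𝒳 : Fin t → Type*}
    {n : ℕ} {R : ℝ} {Rs : Fin h → ℝ} (c : SimulationCode V 𝒳 n R Rs)
    (x : ∀ i : Fin t, Fin n → 𝒳 i) : ℝ :=
  ∑ w : (∀ j : Fin h, Fin (indexCount n (Rs j))), ∑ m : Fin (indexCount n R), c.joint w m x

/-- The i.i.d. target law `q^{(n)}(x_1^n, …, x_t^n) = ∏_k q(x_{1k}, …, x_{tk})`. -/
def iidTarget {t : ℕ} {𝒳 : Fin t → Type*} (q : PMF (∀ i, 𝒳 i)) (n : ℕ)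
    (x : ∀ i : Fin t, Fin n → 𝒳 i) : ℝ :=
  ∏ k : Fin n, (q (fun i => x i k)).toReal

/-- A non-negative rate tuple `(R, R_1, …, R_h)` is achievable for `q` if there is a sequence of
simulation codes, one for each block length, whose induced output laws approach the i.i.d. law of
`q` in `ℓ¹` distance. -/
def Achievable {t h : ℕ} (V : Fin t → Finset (Fin h)) {𝒳 : Fin t → Type*} [∀ i, Fintype (𝒳 i)]
    (q : PMF (∀ i, 𝒳 i)) (r : ℝ × (Fin h → ℝ)) : Prop :=
  0 ≤ r.1 ∧ (∀ j, 0 ≤ r.2 j) ∧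
    ∃ c : ∀ n : ℕ, SimulationCode V 𝒳 n r.1 r.2,
      Filter.Tendsto
        (fun n : ℕ => ∑ x : (∀ i : Fin t, Fin n → 𝒳 i), |(c n).induced x - iidTarget q n x|)
        Filter.atTop (nhds 0)

/-- The simulation rate region: the closure of the set of achievable rate tuples. -/
def simulationRateRegion {t h : ℕ} (V : Fin t → Finset (Fin h)) {𝒳 : Fin t → Type*}
    [∀ i, Fintype (𝒳 i)] (q : PMF (∀ i, 𝒳 i)) : Set (ℝ × (Fin h → ℝ)) :=
  closure {r | Achievable V q r}

/-- Randomness on the forehead: there are as many sources as processors, and processor `i` observes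
every source except the `i`-th. -/
def foreheadAccess (t : ℕ) (i : Fin t) : Finset (Fin t) := Finset.univ \ {i}

/-- The simulation rate region of the randomness-on-the-forehead model. -/
def foreheadRegion {t : ℕ} {𝒳 : Fin t → Type*} [∀ i, Fintype (𝒳 i)] (q : PMF (∀ i, 𝒳 i)) :
    Set (ℝ × (Fin t → ℝ)) :=
  simulationRateRegion (foreheadAccess t) q

/-- Shannon entropy, in bits, of a probability mass function on a finite set
(with `0 log 0 = 0`). -/
def shannonEntropy {α : Type*} [Fintype α] (p : PMF α) : ℝ :=
  ∑ a : α, -((p a).toReal * Real.logb 2 (p a).toReal)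

end

open Filter Topology

/-! All processors must output the same word, which carries about `n * H(X)` random bits, so the
question is how much randomness they can share. With `jm` a source of largest rate, the constraints
together say that `H(X)` is at most `R` plus the sum of `min R (R_j)` over `j ≠ jm`.

Achievability: the sources are reduced modulo `a`, the smaller of the number of values of source
`jm` and the number of messages. The message carries the sum of the residues, from which each
processor solves for the one residue it does not see, and a fresh uniform index that fills the rest
of the message. All residues and the index form a common seed, nearly uniform by `residues_mass_le`,
and `exists_map_l1_le` turns any sufficiently spread seed into an approximation of the i.i.d. law.

Converse: if the outputs agree with high probability, the common word is mostly the likeliest output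
of every decoder. Processor `j` thus confines it to a list, one word per message, that ignores
`W_j`. A typical word has mass about `2 ^ (-n H(X))`. Revealing the sources in `S` multiplies this
by at most the number of their values. By `sum_mul_indicator_insert_le`, revealing a further source
multiplies it by at most about the number of messages, outside an event of small probability. Once
every source but `j₀` is revealed, the list of processor `j₀` must carry almost all the mass, which
costs a last factor of the number of messages. With `|S| = t - i` that number enters to the power
`i`. This is `sum_le_of_forehead_lists`, applied to codes in `forehead_one_shot_converse`. -/

/-! ### Large deviations and typical words. -/

/-- The moment generating function of `f - c` equals `1` at `0` and has there the negative
derivative `E f - c`, so it drops below `1` just to the right of `0`. -/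
lemma exists_pos_sum_mul_exp_lt_one {α : Type*} [Fintype α] (p f : α → ℝ) (c : ℝ)
    (hp1 : ∑ a, p a = 1) (hc : ∑ a, p a * f a < c) :
    ∃ s : ℝ, 0 < s ∧ ∑ a, p a * Real.exp (s * (f a - c)) < 1 := by
  have hd : HasDerivAt (fun s : ℝ => ∑ a, p a * Real.exp (s * (f a - c)))
      (∑ a, p a * (f a - c)) 0 := by
    apply HasDerivAt.fun_sum
    intro a _
    have h1 : HasDerivAt (fun s : ℝ => s * (f a - c)) (f a - c) 0 := by
      simpa using (hasDerivAt_id (0 : ℝ)).mul_const (f a - c)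
    simpa using (h1.exp).const_mul (p a)
  have hneg : ∑ a, p a * (f a - c) < 0 := by
    simp only [mul_sub, Finset.sum_sub_distrib, ← Finset.sum_mul, hp1]
    linarith
  have ht := (hasDerivAt_iff_tendsto_slope.1 hd).mono_left
    (nhdsWithin_mono (0 : ℝ) (fun x (hx : x ∈ Set.Ioi 0) => (ne_of_gt hx : x ≠ 0)))
  obtain ⟨s, hs, hs0⟩ := ((ht.eventually (gt_mem_nhds hneg)).and self_mem_nhdsWithin).exists
  refine ⟨s, hs0, ?_⟩
  have hs0' : (0 : ℝ) < s := hs0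
  rw [slope_def_field, div_lt_iff₀ (by simpa using hs0')] at hs
  simp only [zero_mul, Real.exp_zero, mul_one, hp1] at hs
  linarith

/-- The weak law of large numbers for finite alphabets, in one-sided form. -/
lemma tendsto_sum_prod_of_mean_lt {α : Type*} [Fintype α] (p f : α → ℝ) (c : ℝ)
    (hp : ∀ a, 0 ≤ p a) (hp1 : ∑ a, p a = 1) (hc : ∑ a, p a * f a < c) :
    Tendsto (fun n : ℕ => ∑ y : Fin n → α with n * c ≤ ∑ k, f (y k), ∏ k, p (y k))
      atTop (𝓝 0) := by
  obtain ⟨s, hs, hlt⟩ := exists_pos_sum_mul_exp_lt_one p f c hp1 hc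
  refine squeeze_zero (fun n => Finset.sum_nonneg fun y _ => Finset.prod_nonneg fun k _ => hp _)
    (fun n => ?_) (tendsto_pow_atTop_nhds_zero_of_lt_one
      (Finset.sum_nonneg fun a _ => mul_nonneg (hp a) (Real.exp_pos (s * (f a - c))).le) hlt)
  -- Chernoff bound: the `n`-th power of the moment generating function expands over words, and on
  -- the tail event the exponential factor is at least `1`.
  rw [Fintype.sum_pow, Finset.sum_filter]
  refine Finset.sum_le_sum fun y _ => ?_
  have h0 : 0 ≤ ∏ k, p (y k) := Finset.prod_nonneg fun k _ => hp _
  rw [Finset.prod_mul_distrib, ← Real.exp_sum]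
  split_ifs with h
  · refine le_mul_of_one_le_right h0 (Real.one_le_exp ?_)
    rw [← Finset.mul_sum, Finset.sum_sub_distrib]
    refine mul_nonneg hs.le ?_
    simpa using h
  · exact mul_nonneg h0 (Real.exp_pos _).le

lemma PMF.sum_toReal_eq_one {α : Type*} [Fintype α] (p : PMF α) : ∑ a, (p a).toReal = 1 := by
  rw [← ENNReal.toReal_sum (fun a _ => p.apply_ne_top a), ← tsum_fintype (L := .unconditional _),
    p.tsum_coe, ENNReal.toReal_one]

lemma sum_prod_eq_one {α : Type*} [Fintype α] {p : α → ℝ} (hp1 : ∑ a, p a = 1) (n : ℕ) :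
    ∑ y : Fin n → α, ∏ k, p (y k) = 1 := by
  rw [← Fintype.sum_pow, hp1, one_pow]

/-- Half of the asymptotic equipartition property, used in the converse: unusually likely words are
rare. The law of large numbers is applied to `logb 2` of the letter probabilities. -/
lemma tendsto_sum_prod_gt_two_rpow {α : Type*} [Fintype α] (pX : PMF α) (c : ℝ)
    (hc : c < shannonEntropy pX) :
    Tendsto (fun n : ℕ => ∑ y : Fin n → α with
      (2 : ℝ) ^ (-(n * c)) < ∏ k, (pX (y k)).toReal, ∏ k, (pX (y k)).toReal) atTop (𝓝 0) := by
  have h := tendsto_sum_prod_of_mean_lt (fun a => (pX a).toReal)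
    (fun a => Real.logb 2 (pX a).toReal) (-c) (fun _ => ENNReal.toReal_nonneg)
    pX.sum_toReal_eq_one (by
      simp only [shannonEntropy, Finset.sum_neg_distrib] at hc; linarith)
  refine squeeze_zero (fun n => Finset.sum_nonneg fun y _ => Finset.prod_nonneg fun k _ =>
    ENNReal.toReal_nonneg) (fun n => ?_) h
  refine Finset.sum_le_sum_of_subset_of_nonneg ?_ fun y _ _ => Finset.prod_nonneg fun k _ =>
    ENNReal.toReal_nonneg
  intro y
  simp only [Finset.mem_filter, Finset.mem_univ, true_and]
  intro hy
  have hpos : 0 < ∏ k, (pX (y k)).toReal := lt_trans (by positivity) hy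
  have hne : ∀ k ∈ Finset.univ, (pX (y k)).toReal ≠ 0 := Finset.prod_ne_zero_iff.1 hpos.ne'
  rw [← Real.logb_prod _ _ hne]
  have := (Real.le_logb_iff_rpow_le (by norm_num) hpos).2 hy.le
  linarith

/-- The other half, used for achievability. -/
lemma tendsto_sum_prod_le_two_rpow {α : Type*} [Fintype α] (pX : PMF α) (c : ℝ)
    (hc : shannonEntropy pX < c) :
    Tendsto (fun n : ℕ => ∑ y : Fin n → α with
      ∏ k, (pX (y k)).toReal ≤ (2 : ℝ) ^ (-(n * c)), ∏ k, (pX (y k)).toReal) atTop (𝓝 0) := by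
  have h := tendsto_sum_prod_of_mean_lt (fun a => (pX a).toReal)
    (fun a => - Real.logb 2 (pX a).toReal) c (fun _ => ENNReal.toReal_nonneg)
    pX.sum_toReal_eq_one (by
      simpa only [shannonEntropy, mul_neg] using hc)
  refine squeeze_zero (fun n => Finset.sum_nonneg fun y _ => Finset.prod_nonneg fun k _ =>
    ENNReal.toReal_nonneg) (fun n => ?_) h
  rw [Finset.sum_filter, Finset.sum_filter]
  refine Finset.sum_le_sum fun y _ => ?_
  have h0 : 0 ≤ ∏ k, (pX (y k)).toReal := Finset.prod_nonneg fun k _ => ENNReal.toReal_nonneg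
  -- Words of probability zero are treated apart: `logb 2 0 = 0` would break the passage to
  -- logarithms, but they add nothing to the sum.
  rcases h0.eq_or_lt with h0 | hpos
  · simp [← h0]
  by_cases hy : ∏ k, (pX (y k)).toReal ≤ (2 : ℝ) ^ (-(n * c))
  · have hne : ∀ k ∈ Finset.univ, (pX (y k)).toReal ≠ 0 := Finset.prod_ne_zero_iff.1 hpos.ne'
    rw [if_pos hy, if_pos]
    rw [Finset.sum_neg_distrib, ← Real.logb_prod _ _ hne]
    have := (Real.logb_le_iff_le_rpow (by norm_num) hpos).2 hy
    linarith
  · rw [if_neg hy]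
    split_ifs <;> linarith

/-! ### Approximating a law by a function of a spread-out seed. -/

/-- The number of words of large probability. -/
lemma card_filter_lt_le {A : Type*} [Fintype A] (q : A → ℝ) (hq : ∀ a, 0 ≤ q a)
    (hq1 : ∑ a, q a = 1) {θ : ℝ} (hθ : 0 < θ) :
    ((Finset.univ.filter fun a => θ < q a).card : ℝ) ≤ θ⁻¹ := by
  rw [← one_div, le_div_iff₀ hθ, ← hq1]
  calc _ = ∑ a with θ < q a, θ := by rw [Finset.sum_const, nsmul_eq_mul]
    _ ≤ ∑ a with θ < q a, q a := Finset.sum_le_sum fun a ha => (Finset.mem_filter.1 ha).2.le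
    _ ≤ ∑ a, q a := Finset.sum_le_univ_sum_of_nonneg hq

open Classical in
/-- A finite distribution `q` is approximated by a deterministic function of any source whose
atoms have mass at most `η`. -/
lemma exists_map_l1_le {A B : Type*} [Fintype A] [Nonempty A] [Fintype B] (p : B → ℝ) (q : A → ℝ)
    {η : ℝ} (hp : ∀ b, 0 ≤ p b) (hpη : ∀ b, p b ≤ η) (hp1 : ∑ b, p b = 1)
    (hq : ∀ a, 0 ≤ q a) (hq1 : ∑ a, q a = 1) :
    ∃ g : B → A, ∀ T : Finset A,
      ∑ a, |(∑ b with g b = a, p b) - q a| ≤ 2 * (T.card * η + ∑ a ∈ Tᶜ, q a) := by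
  have hη : 0 ≤ η := by
    by_contra h
    have : ∑ b, p b ≤ 0 := Finset.sum_nonpos fun b _ => (hpη b).trans (not_le.1 h).le
    linarith
  -- Greedy packing: atoms of `p` are placed into letters without overfilling any, as many atoms as
  -- possible. If an atom is left over, no letter has room for it, so every deficit is below `η`; if
  -- none is left over, the total masses agree and no letter has a deficit.
  obtain ⟨g, hg, hmax⟩ := Finset.exists_max_image
    (Finset.univ.filter fun g : B → Option A => ∀ a, ∑ b with g b = some a, p b ≤ q a)
    (fun g => (Finset.univ.filter fun b => g b ≠ none).card)
    ⟨fun _ => none, by simpa using hq⟩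
  simp only [Finset.mem_filter, Finset.mem_univ, true_and] at hg hmax
  have hlow : ∀ a, q a - η ≤ ∑ b with g b = some a, p b := by
    intro a
    by_cases hall : ∀ b, g b ≠ none
    · have hsum : ∑ a, ∑ b with g b = some a, p b = 1 := by
        rw [← hp1, ← Finset.sum_fiberwise (s := Finset.univ) (g := g) (f := p),
          Fintype.sum_option]
        simp [hall]
      have := (Finset.sum_eq_sum_iff_of_le (fun a _ => hg a)).1 (hsum.trans hq1.symm) a
        (Finset.mem_univ a)
      linarith
    · push Not at hall
      obtain ⟨b₀, hb₀⟩ := hall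
      by_contra hlt
      push Not at hlt
      have h := hmax (Function.update g b₀ (some a)) (by
        intro a'
        rw [Finset.sum_filter]
        have hcongr : ∀ b, (if Function.update g b₀ (some a) b = some a' then p b else 0)
            = (if g b = some a' then p b else 0) + (if b = b₀ then if a = a' then p b else 0 else 0) := by
          intro b
          by_cases hb : b = b₀
          · subst hb; simp [hb₀]
          · simp [hb]
        rw [Finset.sum_congr rfl fun b _ => hcongr b, Finset.sum_add_distrib,
          Finset.sum_ite_eq' Finset.univ b₀, ← Finset.sum_filter]
        by_cases ha : a = a'
        · subst ha
          simp only [Finset.mem_univ, if_true]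
          linarith [hpη b₀]
        · simpa [ha] using hg a')
      have hlt' : (Finset.univ.filter fun b => g b ≠ none) ⊂
          Finset.univ.filter fun b => Function.update g b₀ (some a) b ≠ none := by
        rw [Finset.ssubset_iff_of_subset]
        · exact ⟨b₀, by simp, by simp [hb₀]⟩
        · intro b
          by_cases hb : b = b₀
          · subst hb; simp
          · simp [hb]
      exact absurd (Finset.card_lt_card hlt') (not_lt.2 h)
  obtain ⟨a₀⟩ := ‹Nonempty A›
  refine ⟨fun b => (g b).getD a₀, fun T => ?_⟩
  set P : A → ℝ := fun a => ∑ b with (g b).getD a₀ = a, p b with hP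
  have hP1 : ∑ a, P a = 1 := by
    rw [← hp1, ← Finset.sum_fiberwise (s := Finset.univ) (g := fun b => (g b).getD a₀) (f := p)]
  have hPlow : ∀ a, q a - η ≤ P a := fun a => (hlow a).trans <|
    Finset.sum_le_sum_of_subset_of_nonneg (fun b => by
      simp only [Finset.mem_filter, Finset.mem_univ, true_and]
      intro h; simp [h]) fun b _ _ => hp b
  have hP0 : ∀ a, 0 ≤ P a := fun a => Finset.sum_nonneg fun b _ => hp b
  -- `P` and `q` have the same total mass, so the `ℓ¹` distance is twice the sum of the positive
  -- deficits.
  have hkey : ∀ a, |P a - q a| = (P a - q a) + 2 * max (q a - P a) 0 := by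
    intro a
    rcases le_total (P a) (q a) with h | h
    · rw [abs_of_nonpos (by linarith), max_eq_left (by linarith)]; ring
    · rw [abs_of_nonneg (by linarith), max_eq_right (by linarith)]; ring
  rw [Finset.sum_congr rfl fun a _ => hkey a, Finset.sum_add_distrib, Finset.sum_sub_distrib, hP1,
    hq1, sub_self, zero_add, ← Finset.mul_sum]
  refine mul_le_mul_of_nonneg_left ?_ (by norm_num)
  rw [← Finset.sum_add_sum_compl T]
  refine add_le_add ?_ (Finset.sum_le_sum fun a _ => max_le (by linarith [hP0 a]) (hq a))
  rw [← nsmul_eq_mul]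
  exact Finset.sum_le_card_nsmul _ _ _ fun a _ => max_le (by linarith [hPlow a]) hη

/-! ### Conditional expectations for independent uniform sources. -/

section PartialAverage

lemma piecewise_swap_self {ι : Type*} [DecidableEq ι] {Ω : ι → Type*} (T : Finset ι) (w w' : ∀ j, Ω j) :
    T.piecewise (T.piecewise w w') (T.piecewise w' w) = w := by
  ext j; by_cases h : j ∈ T <;> simp [h]

variable {ι : Type*} [Fintype ι] [DecidableEq ι] {Ω : ι → Type*} [∀ j, Fintype (Ω j)]

/-- The average of `f` over the coordinates outside `T`, for independent uniform coordinates. -/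
noncomputable def partialAverage (T : Finset ι) (f : (∀ j, Ω j) → ℝ) (w : ∀ j, Ω j) : ℝ :=
  (∑ w' : ∀ j, Ω j, f (T.piecewise w w')) / Fintype.card (∀ j, Ω j)

lemma partialAverage_piecewise (T : Finset ι) (f : (∀ j, Ω j) → ℝ) (w w' : ∀ j, Ω j) :
    partialAverage T f (T.piecewise w w') = partialAverage T f w := by
  simp [partialAverage]

lemma partialAverage_mono (T : Finset ι) {f g : (∀ j, Ω j) → ℝ} (h : ∀ w, f w ≤ g w)
    (w : ∀ j, Ω j) : partialAverage T f w ≤ partialAverage T g w :=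
  div_le_div_of_nonneg_right (Finset.sum_le_sum fun _ _ => h _) (Nat.cast_nonneg _)

lemma partialAverage_nonneg (T : Finset ι) {f : (∀ j, Ω j) → ℝ} (h : ∀ w, 0 ≤ f w)
    (w : ∀ j, Ω j) : 0 ≤ partialAverage T f w :=
  div_nonneg (Finset.sum_nonneg fun _ _ => h _) (Nat.cast_nonneg _)

/-- The tower property of conditional expectations. -/
lemma sum_partialAverage_mul [∀ j, Nonempty (Ω j)] (T : Finset ι) (f g : (∀ j, Ω j) → ℝ)
    (hg : ∀ w w', g (T.piecewise w w') = g w) :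
    ∑ w, partialAverage T f w * g w = ∑ w, f w * g w := by
  have hcard : (Fintype.card (∀ j, Ω j) : ℝ) ≠ 0 := Nat.cast_ne_zero.2 Fintype.card_ne_zero
  -- Two independent copies exchange their coordinates outside `T`; this preserves the uniform law
  -- on pairs and is invisible to `g`.
  let e : ((∀ j, Ω j) × (∀ j, Ω j)) ≃ ((∀ j, Ω j) × (∀ j, Ω j)) :=
    { toFun := fun v => (T.piecewise v.1 v.2, T.piecewise v.2 v.1)
      invFun := fun v => (T.piecewise v.1 v.2, T.piecewise v.2 v.1)
      left_inv := fun v => by simp only [piecewise_swap_self]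
      right_inv := fun v => by simp only [piecewise_swap_self] }
  have h : ∑ v : (∀ j, Ω j) × (∀ j, Ω j), f (T.piecewise v.1 v.2) * g v.1
      = ∑ v : (∀ j, Ω j) × (∀ j, Ω j), f v.1 * g v.1 :=
    Fintype.sum_equiv e _ _ fun v => by simp [e, hg]
  rw [Fintype.sum_prod_type, Fintype.sum_prod_type] at h
  simp only [Finset.sum_const, nsmul_eq_mul, Finset.card_univ, ← Finset.sum_mul,
    ← Finset.mul_sum] at h
  simp only [partialAverage, div_mul_eq_mul_div, ← Finset.sum_div, h]
  field_simp

/-- Applied to the list of processor `j`, which ignores source `j`: revealing that source does not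
change its conditional mean. -/
lemma partialAverage_insert_eq {j : ι} (T : Finset ι) (f : (∀ j, Ω j) → ℝ)
    (hf : ∀ w a, f (Function.update w j a) = f w) (w : ∀ j, Ω j) :
    partialAverage (insert j T) f w = partialAverage T f w := by
  unfold partialAverage
  congr 1
  refine Finset.sum_congr rfl fun w' _ => ?_
  rw [Finset.piecewise_insert, hf]

lemma partialAverage_eq_self [∀ j, Nonempty (Ω j)] (T : Finset ι) (f : (∀ j, Ω j) → ℝ)
    (hf : ∀ w w', f (T.piecewise w w') = f w) (w : ∀ j, Ω j) :
    partialAverage T f w = f w := by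
  have hcard : (Fintype.card (∀ j, Ω j) : ℝ) ≠ 0 := Nat.cast_ne_zero.2 Fintype.card_ne_zero
  simp only [partialAverage, hf, Finset.sum_const, nsmul_eq_mul, Finset.card_univ]
  field_simp

/-- Conditioning on the coordinates in `T` increases a mass by at most the number of values of
these coordinates. -/
lemma partialAverage_le [∀ j, Nonempty (Ω j)] (T : Finset ι) (f : (∀ j, Ω j) → ℝ)
    (hf : ∀ w, 0 ≤ f w) (v : ∀ j, Ω j) :
    partialAverage T f v ≤
      (∏ j ∈ T, (Fintype.card (Ω j) : ℝ)) * ((∑ w, f w) / Fintype.card (∀ j, Ω j)) := by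
  classical
  have hcard : (0 : ℝ) < Fintype.card (∀ j, Ω j) := Nat.cast_pos.2 Fintype.card_pos
  set P : (∀ j, Ω j) → Prop := fun w => ∀ j ∈ T, w j = v j with hP
  -- The tower property is tested on the event of agreeing with `v` on `T`, where the partial
  -- average is constant; the event has probability one over the product of the cardinalities in
  -- `T`.
  have hg := sum_partialAverage_mul T f (fun w => if P w then 1 else 0) (by
    intro w w'
    have : P (T.piecewise w w') ↔ P w := by
      simp only [hP]
      refine forall₂_congr fun j hj => ?_
      rw [Finset.piecewise_eq_of_mem _ _ _ hj]
    simp only [this])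
  have hle : ∑ w, f w * (if P w then 1 else 0) ≤ ∑ w, f w :=
    Finset.sum_le_sum fun w _ => by split_ifs <;> simp [hf w]
  have hPv : ∀ w, partialAverage T f w * (if P w then 1 else 0)
      = if P w then partialAverage T f v else 0 := by
    intro w
    split_ifs with h
    · rw [mul_one, ← partialAverage_piecewise T f w v]
      congr 1
      ext j
      by_cases hj : j ∈ T
      · simp [hj, h j hj]
      · simp [hj]
    · simp
  have hset : (Finset.univ.filter P) =
      Fintype.piFinset fun j => if j ∈ T then {v j} else Finset.univ := by
    ext w
    simp only [Finset.mem_filter, Finset.mem_univ, true_and, Fintype.mem_piFinset, hP]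
    refine forall_congr' fun j => ?_
    by_cases hj : j ∈ T <;> simp [hj]
  have hcnt : (∏ j ∈ T, (Fintype.card (Ω j) : ℝ)) * (Finset.univ.filter P).card
      = Fintype.card (∀ j, Ω j) := by
    rw [hset, Fintype.card_piFinset, Fintype.card_pi]
    push_cast
    have h1 : ∏ j ∈ T, ((if j ∈ T then {v j} else Finset.univ : Finset (Ω j)).card : ℝ) = 1 :=
      Finset.prod_eq_one fun j hj => by simp [hj]
    have h2 : ∏ j ∈ Tᶜ, ((if j ∈ T then {v j} else Finset.univ : Finset (Ω j)).card : ℝ) =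
        ∏ j ∈ Tᶜ, (Fintype.card (Ω j) : ℝ) :=
      Finset.prod_congr rfl fun j hj => by simp [Finset.mem_compl.1 hj]
    rw [← Finset.prod_mul_prod_compl T (fun j => (Fintype.card (Ω j) : ℝ)),
      ← Finset.prod_mul_prod_compl T, h1, h2, one_mul]
  simp only [hPv] at hg
  rw [← Finset.sum_filter, Finset.sum_const, nsmul_eq_mul] at hg
  rw [← mul_div_assoc, le_div_iff₀ hcard, ← hcnt]
  calc _ = (∏ j ∈ T, (Fintype.card (Ω j) : ℝ)) *
        ((Finset.univ.filter P).card * partialAverage T f v) := by ring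
    _ ≤ _ := by
      rw [hg]
      exact mul_le_mul_of_nonneg_left hle (Finset.prod_nonneg fun _ _ => Nat.cast_nonneg _)

/-! ### Revealing the sources one at a time. -/

variable [∀ j, Nonempty (Ω j)] {A : Type*} [Fintype A]

/-- One step of the converse: revealing the coordinate `j`, on which `c` does not depend,
increases the conditional mass of `y` by more than the factor `l * L` with probability at
most `1 / l`. -/
lemma sum_mul_indicator_insert_le (f c : A → (∀ j, Ω j) → ℝ) (j : ι) (T : Finset ι) {l L C : ℝ}
    (hl : 0 < l) (hL : 0 < L) (hf : ∀ y w, 0 ≤ f y w) (hfc : ∀ y w, f y w ≤ c y w)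
    (hc : ∀ y w a, c y (Function.update w j a) = c y w)
    (hcL : ∀ w, ∑ y, c y w = L) (G : Finset A) :
    ∑ y ∈ G, ∑ w, f y w * (if l * L * C < partialAverage (insert j T) (f y) w then 1 else 0) ≤
      ∑ y ∈ G, ∑ w, f y w * (if C < partialAverage T (f y) w then 1 else 0) +
        Fintype.card (∀ j, Ω j) / l := by
  classical
  have hc0 : ∀ y w, 0 ≤ c y w := fun y w => (hf y w).trans (hfc y w)
  -- `B` marks the words whose conditional mass given `T` is less than `1 / (l * L)` of their
  -- expected list multiplicity. As `f ≤ c` and revealing `j` leaves the mean of `c` unchanged, the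
  -- mass can jump past the factor `l * L` only on `B`; as the multiplicities sum to `L`, `B` has
  -- `f`-mass at most `1 / l`.
  set B : A → (∀ j, Ω j) → ℝ := fun y w =>
    if l * L * partialAverage T (f y) w < partialAverage T (c y) w then 1 else 0 with hB
  have hB1 : ∀ y w, B y w ≤ 1 := fun y w => by simp only [hB]; split_ifs <;> norm_num
  have hpt : ∀ y w, (if l * L * C < partialAverage (insert j T) (f y) w then (1 : ℝ) else 0) ≤
      (if C < partialAverage T (f y) w then 1 else 0) + B y w := by
    intro y w
    by_cases h1 : C < partialAverage T (f y) w
    · rw [if_pos h1]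
      simp only [hB]
      split_ifs <;> norm_num
    · rw [if_neg h1]
      by_cases h2 : l * L * C < partialAverage (insert j T) (f y) w
      · have h3 : l * L * partialAverage T (f y) w < partialAverage T (c y) w :=
          calc _ ≤ l * L * C := mul_le_mul_of_nonneg_left (not_lt.1 h1) (by positivity)
            _ < _ := h2
            _ ≤ partialAverage (insert j T) (c y) w := partialAverage_mono _ (hfc y) w
            _ = _ := partialAverage_insert_eq T (c y) (hc y) w
        simp [hB, h3, h2]
      · rw [if_neg h2]
        simp only [hB]
        split_ifs <;> norm_num
  have hstep : ∀ y, ∑ w, f y w * B y w ≤ (∑ w, c y w) / (l * L) := by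
    intro y
    rw [← sum_partialAverage_mul T (f y) (B y) (fun w w' => by
      simp only [hB, partialAverage_piecewise])]
    have hone := sum_partialAverage_mul T (c y) (fun _ => 1) (fun _ _ => rfl)
    simp only [mul_one] at hone
    rw [← hone, Finset.sum_div]
    refine Finset.sum_le_sum fun w _ => ?_
    simp only [hB]
    split_ifs with h
    · rw [mul_one, le_div_iff₀ (by positivity)]
      linarith
    · rw [mul_zero]
      exact div_nonneg (partialAverage_nonneg _ (hc0 y) w) (by positivity)
  calc _ ≤ ∑ y ∈ G, ∑ w, (f y w * (if C < partialAverage T (f y) w then 1 else 0) +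
        f y w * B y w) := Finset.sum_le_sum fun y _ => Finset.sum_le_sum fun w _ => by
          rw [← mul_add]; exact mul_le_mul_of_nonneg_left (hpt y w) (hf y w)
    _ = ∑ y ∈ G, ∑ w, f y w * (if C < partialAverage T (f y) w then 1 else 0) +
        ∑ y ∈ G, ∑ w, f y w * B y w := by simp only [Finset.sum_add_distrib]
    _ ≤ _ := by
      refine add_le_add le_rfl ?_
      calc _ ≤ ∑ y ∈ G, (∑ w, c y w) / (l * L) := Finset.sum_le_sum fun y _ => hstep y
        _ ≤ ∑ y, (∑ w, c y w) / (l * L) := Finset.sum_le_univ_sum_of_nonneg fun y =>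
            div_nonneg (Finset.sum_nonneg fun w _ => hc0 y w) (by positivity)
        _ = _ := by
          rw [← Finset.sum_div, Finset.sum_comm]
          simp only [hcL, Finset.sum_const, nsmul_eq_mul, Finset.card_univ]
          field_simp

/-- Revealing the coordinates of `U` one after the other, on top of those of `S`. -/
lemma sum_mul_indicator_union_le (f : A → (∀ j, Ω j) → ℝ) (c : ι → A → (∀ j, Ω j) → ℝ)
    (S U : Finset ι) {l L C : ℝ}
    (hl : 0 < l) (hL : 0 < L) (hf : ∀ y w, 0 ≤ f y w) (hfc : ∀ j y w, f y w ≤ c j y w)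
    (hc : ∀ j y w a, c j y (Function.update w j a) = c j y w)
    (hcL : ∀ j w, ∑ y, c j y w = L) (G : Finset A)
    (hC : ∀ y ∈ G, ∀ w, partialAverage S (f y) w ≤ C) :
    ∑ y ∈ G, ∑ w, f y w *
        (if (l * L) ^ U.card * C < partialAverage (U ∪ S) (f y) w then 1 else 0) ≤
      U.card * (Fintype.card (∀ j, Ω j) / l) := by
  induction U using Finset.induction_on with
  | empty =>
    simp only [Finset.card_empty, pow_zero, one_mul, Finset.empty_union, Nat.cast_zero, zero_mul]
    refine (Finset.sum_eq_zero fun y hy => Finset.sum_eq_zero fun w _ => ?_).le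
    rw [if_neg (not_lt.2 (hC y hy w)), mul_zero]
  | insert j U hj ih =>
    rw [Finset.card_insert_of_notMem hj, Finset.insert_union, pow_succ', mul_assoc (l * L)]
    refine (sum_mul_indicator_insert_le f (c j) j (U ∪ S) hl hL hf (hfc j) (hc j) (hcL j) G).trans ?_
    push_cast
    linarith

/-- The mass of a law on `A` that is recovered from each of the lists `c j`, where the `j`-th list
does not depend on the `j`-th coordinate. -/
lemma sum_le_of_forehead_lists (f : A → (∀ j, Ω j) → ℝ) (c : ι → A → (∀ j, Ω j) → ℝ)
    (S : Finset ι) (j₀ : ι) (hj₀ : j₀ ∉ S) {l L K : ℝ}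
    (hl : 0 < l) (hL : 0 < L) (hf : ∀ y w, 0 ≤ f y w) (hfc : ∀ j y w, f y w ≤ c j y w)
    (hc : ∀ j y w a, c j y (Function.update w j a) = c j y w)
    (hcint : ∀ j y w, c j y w = 0 ∨ 1 ≤ c j y w)
    (hcL : ∀ j w, ∑ y, c j y w = L) (G : Finset A) (hK0 : 0 ≤ K)
    (hK : ∀ y ∈ G, (∑ w, f y w) / Fintype.card (∀ j, Ω j) ≤ K) :
    ∑ y ∈ G, (∑ w, f y w) / Fintype.card (∀ j, Ω j) ≤
      ((Sᶜ.erase j₀).card : ℝ) / l +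
        L * ((l * L) ^ (Sᶜ.erase j₀).card * ((∏ j ∈ S, (Fintype.card (Ω j) : ℝ)) * K)) := by
  classical
  have hcard : (0 : ℝ) < Fintype.card (∀ j, Ω j) := Nat.cast_pos.2 Fintype.card_pos
  set U := Sᶜ.erase j₀ with hU
  set C := (∏ j ∈ S, (Fintype.card (Ω j) : ℝ)) * K with hCdef
  have hC0 : 0 ≤ C := mul_nonneg (Finset.prod_nonneg fun _ _ => Nat.cast_nonneg _) hK0
  have hUS : ∀ i, i ∈ U ∪ S ↔ i ≠ j₀ := by
    intro i
    simp only [hU, Finset.mem_union, Finset.mem_erase, Finset.mem_compl]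
    by_cases h : i = j₀
    · subst h; simp [hj₀]
    · simp [h, em']
  have h1 := sum_mul_indicator_union_le f c S U hl hL hf hfc hc hcL G (C := C) (fun y hy w =>
    (partialAverage_le S (f y) (hf y) w).trans
      (mul_le_mul_of_nonneg_left (hK y hy) (Finset.prod_nonneg fun _ _ => Nat.cast_nonneg _)))
  set D := (l * L) ^ U.card * C with hD
  have hD0 : 0 ≤ D := by positivity
  have hcT : ∀ y w w', c j₀ y ((U ∪ S).piecewise w w') = c j₀ y w := by
    intro y w w'
    have : (U ∪ S).piecewise w w' = Function.update w j₀ (w' j₀) := by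
      ext i
      by_cases h : i = j₀
      · subst h
        rw [Finset.piecewise_eq_of_notMem _ _ _ (by rw [hUS]; simp), Function.update_self]
      · rw [Finset.piecewise_eq_of_mem _ _ _ ((hUS i).2 h), Function.update_of_ne h]
    rw [this, hc]
  -- Given all coordinates but `j₀`, the list `c j₀` is determined. Words off the list have
  -- conditional mass zero, and those counted here have mass at most `D` each, so the list bounds
  -- their total by `L * D`.
  have h2 : ∑ y ∈ G, ∑ w, f y w * (if D < partialAverage (U ∪ S) (f y) w then 0 else 1) ≤
      Fintype.card (∀ j, Ω j) * (L * D) := by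
    calc _ ≤ ∑ y ∈ G, ∑ w, D * c j₀ y w := by
          refine Finset.sum_le_sum fun y _ => ?_
          rw [← sum_partialAverage_mul (U ∪ S) (f y) _ (fun w w' => by
            simp only [partialAverage_piecewise])]
          refine Finset.sum_le_sum fun w _ => ?_
          have hle := partialAverage_mono (U ∪ S) (hfc j₀ y) w
          rw [partialAverage_eq_self _ _ (hcT y)] at hle
          have hn := partialAverage_nonneg (U ∪ S) (hf y) w
          split_ifs with h
          · rw [mul_zero]; exact mul_nonneg hD0 (hn.trans hle)
          · rw [mul_one]
            rcases hcint j₀ y w with h0 | h0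
            · rw [h0] at hle ⊢; linarith
            · exact (not_lt.1 h).trans (le_mul_of_one_le_right hD0 h0)
      _ ≤ ∑ y, ∑ w, D * c j₀ y w := Finset.sum_le_univ_sum_of_nonneg fun y =>
          Finset.sum_nonneg fun w _ => mul_nonneg hD0 ((hf y w).trans (hfc j₀ y w))
      _ = _ := by
          rw [Finset.sum_comm]
          simp only [← Finset.mul_sum, hcL, Finset.sum_const, nsmul_eq_mul, Finset.card_univ]
          ring
  rw [← Finset.sum_div, div_le_iff₀ hcard]
  calc _ = ∑ y ∈ G, ∑ w, f y w * (if D < partialAverage (U ∪ S) (f y) w then 1 else 0) +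
        ∑ y ∈ G, ∑ w, f y w * (if D < partialAverage (U ∪ S) (f y) w then 0 else 1) := by
        rw [← Finset.sum_add_distrib]
        refine Finset.sum_congr rfl fun y _ => ?_
        rw [← Finset.sum_add_distrib]
        refine Finset.sum_congr rfl fun w _ => ?_
        split_ifs <;> simp
    _ ≤ _ := (add_le_add h1 h2).trans_eq (by ring)

end PartialAverage

/-! ### The one-shot converse. -/

section Converse

/-- A most likely letter of a law. -/
noncomputable def argmax {A : Type*} [Finite A] [Nonempty A] (d : A → ℝ) : A :=
  (Finite.exists_max d).choose

lemma le_argmax {A : Type*} [Finite A] [Nonempty A] (d : A → ℝ) (y : A) : d y ≤ d (argmax d) :=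
  (Finite.exists_max d).choose_spec y

open Classical in
/-- If independent letters agree, then they agree with the most likely one. -/
lemma sum_prod_ne_argmax_le {ι A : Type*} [Fintype ι] [Nontrivial ι] [Fintype A] [Nonempty A]
    (d : ι → A → ℝ) (hd : ∀ i y, 0 ≤ d i y) (hd1 : ∀ i, ∑ y, d i y = 1) (i : ι) :
    ∑ y, (∏ k, d k y) * (if argmax (d i) ≠ y then 1 else 0) + ∑ y, ∏ k, d k y ≤ 1 := by
  obtain ⟨k, hk⟩ := exists_ne i
  have hle1 : ∀ i y, d i y ≤ 1 := fun i y => (hd1 i) ▸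
    Finset.single_le_sum (f := d i) (fun y _ => hd i y) (Finset.mem_univ y)
  have hprod : ∀ y, ∏ k, d k y ≤ d i y * d k y := by
    intro y
    rw [← Finset.mul_prod_erase _ _ (Finset.mem_univ i),
      ← Finset.mul_prod_erase _ _ (Finset.mem_erase.2 ⟨hk, Finset.mem_univ k⟩), ← mul_assoc]
    exact mul_le_of_le_one_right (mul_nonneg (hd i y) (hd k y))
      (Finset.prod_le_one (fun j _ => hd j y) fun j _ => hle1 j y)
  -- Letter `i` matches the independent letter `k` with probability at most its own largest mass;
  -- missing its mode has the complementary probability, so the two bounds add up to `1`.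
  have h1 : ∑ y, ∏ k, d k y ≤ d i (argmax (d i)) :=
    calc _ ≤ ∑ y, d i (argmax (d i)) * d k y := Finset.sum_le_sum fun y _ =>
          (hprod y).trans (mul_le_mul_of_nonneg_right (le_argmax _ y) (hd k y))
      _ = _ := by rw [← Finset.mul_sum, hd1, mul_one]
  have h2 : ∑ y, (∏ k, d k y) * (if argmax (d i) ≠ y then 1 else 0) ≤
      1 - d i (argmax (d i)) :=
    calc _ ≤ ∑ y, (d i y - if argmax (d i) = y then d i y else 0) := by
          refine Finset.sum_le_sum fun y _ => ?_
          have := (hprod y).trans (mul_le_of_le_one_right (hd i y) (hle1 k y))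
          by_cases h : argmax (d i) = y
          · simp [h]
          · simpa [h] using this
      _ = _ := by rw [Finset.sum_sub_distrib, hd1, Finset.sum_ite_eq]; simp
  linarith

/-- The one-shot converse: a law that a forehead code spreads over a set of words of mass at
most `K` each. -/
lemma forehead_one_shot_converse {ι : Type*} [Fintype ι] [DecidableEq ι] [Nontrivial ι]
    {Ω : ι → Type*} [∀ j, Fintype (Ω j)] [∀ j, Nonempty (Ω j)] {M A : Type*} [Fintype M]
    [Nonempty M] [Fintype A] [Nonempty A] (enc : (∀ j, Ω j) → M → ℝ)
    (dec : ι → M → (∀ j, Ω j) → A → ℝ) (henc : ∀ w m, 0 ≤ enc w m) (henc1 : ∀ w, ∑ m, enc w m = 1)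
    (hdec : ∀ i m w y, 0 ≤ dec i m w y) (hdec1 : ∀ i m w, ∑ y, dec i m w y = 1)
    (hdecu : ∀ i m w a, dec i m (Function.update w i a) = dec i m w) (p : A → ℝ)
    (hp : ∀ y, p y = (∑ w, ∑ m, enc w m * ∏ i, dec i m w y) / Fintype.card (∀ j, Ω j))
    (S : Finset ι) (j₀ : ι) (hj₀ : j₀ ∉ S) {l K : ℝ} (hl : 0 < l) (hK0 : 0 ≤ K) (G : Finset A)
    (hK : ∀ y ∈ G, p y ≤ K) :
    ∑ y ∈ G, p y ≤ Fintype.card ι * (1 - ∑ y, p y) + (((Sᶜ.erase j₀).card : ℝ) / l +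
        Fintype.card M * ((l * Fintype.card M) ^ (Sᶜ.erase j₀).card *
          ((∏ j ∈ S, (Fintype.card (Ω j) : ℝ)) * K))) := by
  classical
  have hcard : (0 : ℝ) < Fintype.card (∀ j, Ω j) := Nat.cast_pos.2 Fintype.card_pos
  have henc_le : ∀ w m, enc w m ≤ 1 := fun w m => (henc1 w) ▸
    Finset.single_le_sum (f := enc w) (fun m _ => henc w m) (Finset.mem_univ m)
  have hdec_le : ∀ i m w y, dec i m w y ≤ 1 := fun i m w y => (hdec1 i m w) ▸
    Finset.single_le_sum (f := dec i m w) (fun y _ => hdec i m w y) (Finset.mem_univ y)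
  have hprod0 : ∀ m w y, 0 ≤ ∏ i, dec i m w y := fun m w y =>
    Finset.prod_nonneg fun i _ => hdec i m w y
  have hprod1 : ∀ m w y, ∏ i, dec i m w y ≤ 1 := fun m w y =>
    Finset.prod_le_one (fun i _ => hdec i m w y) fun i _ => hdec_le i m w y
  set e : A → (∀ j, Ω j) → M → ℝ := fun y w m => enc w m * ∏ i, dec i m w y with he
  have he0 : ∀ y w m, 0 ≤ e y w m := fun y w m => mul_nonneg (henc w m) (hprod0 m w y)
  have he1 : ∀ y w m, e y w m ≤ 1 := fun y w m =>
    mul_le_one₀ (henc_le w m) (hprod0 m w y) (hprod1 m w y)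
  -- `f` keeps only the event that all outputs equal `y` and `y` is the mode of every decoder; `c i`
  -- counts the messages for which decoder `i` has mode `y`, so it ignores source `i` and has total
  -- the number of messages.
  set f : A → (∀ j, Ω j) → ℝ := fun y w =>
    ∑ m, e y w m * (if ∀ i, argmax (dec i m w) = y then 1 else 0) with hf
  set c : ι → A → (∀ j, Ω j) → ℝ := fun i y w =>
    ((Finset.univ.filter fun m => argmax (dec i m w) = y).card : ℝ) with hc
  have hf0 : ∀ y w, 0 ≤ f y w := fun y w => Finset.sum_nonneg fun m _ =>
    mul_nonneg (he0 y w m) (by split_ifs <;> norm_num)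
  have hfp : ∀ y, (∑ w, f y w) / Fintype.card (∀ j, Ω j) ≤ p y := by
    intro y
    rw [hp]
    refine div_le_div_of_nonneg_right (Finset.sum_le_sum fun w _ => Finset.sum_le_sum fun m _ =>
      mul_le_of_le_one_right (he0 y w m) ?_) hcard.le
    split_ifs <;> norm_num
  have hmain := sum_le_of_forehead_lists f c S j₀ hj₀ hl
    (L := Fintype.card M) (K := K) (Nat.cast_pos.2 Fintype.card_pos) hf0
    (by
      intro j y w
      simp only [hf, hc, Finset.card_eq_sum_ones, Finset.sum_filter]
      push_cast
      refine Finset.sum_le_sum fun m _ => ?_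
      by_cases h : ∀ i, argmax (dec i m w) = y
      · simpa [h] using he1 y w m
      · rw [if_neg h, mul_zero]
        split_ifs <;> norm_num)
    (by intro j y w a; simp only [hc, hdecu])
    (by
      intro j y w
      simp only [hc]
      rcases Nat.eq_zero_or_pos (Finset.univ.filter fun m => argmax (dec j m w) = y).card with h | h
      · left; rw [h, Nat.cast_zero]
      · right; exact_mod_cast h)
    (by
      intro j w
      simp only [hc]
      simp only [Finset.card_eq_sum_ones, Finset.sum_filter]
      push_cast
      rw [Finset.sum_comm]
      simp)
    G hK0 (fun y hy => (hfp y).trans (hK y hy))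
  -- Restricting to the mode of decoder `i` loses at most the probability that the outputs disagree.
  have hloss : ∀ i, ∑ y, (∑ w, ∑ m, e y w m * (if argmax (dec i m w) ≠ y then 1 else 0)) /
      Fintype.card (∀ j, Ω j) ≤ 1 - ∑ y, p y := by
    intro i
    rw [le_sub_iff_add_le]
    simp only [hp]
    rw [← Finset.sum_div, ← Finset.sum_div, ← add_div, div_le_one hcard]
    rw [Finset.sum_comm, Finset.sum_comm (f := fun y w => ∑ m, enc w m * ∏ i, dec i m w y),
      ← Finset.sum_add_distrib]
    calc _ ≤ ∑ w : (∀ j, Ω j), (1 : ℝ) := by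
          refine Finset.sum_le_sum fun w _ => ?_
          rw [Finset.sum_comm, Finset.sum_comm (f := fun y m => enc w m * ∏ i, dec i m w y),
            ← Finset.sum_add_distrib]
          refine (Finset.sum_le_sum fun m _ => ?_).trans_eq (henc1 w)
          simp only [he, mul_assoc]
          rw [← Finset.mul_sum, ← Finset.mul_sum, ← mul_add]
          exact mul_le_of_le_one_right (henc w m) (sum_prod_ne_argmax_le (fun i => dec i m w)
            (fun i y => hdec i m w y) (fun i => hdec1 i m w) i)
      _ = _ := by simp
  have hsplit : ∀ y, p y ≤ (∑ w, f y w) / Fintype.card (∀ j, Ω j) +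
      ∑ i, (∑ w, ∑ m, e y w m * (if argmax (dec i m w) ≠ y then 1 else 0)) /
        Fintype.card (∀ j, Ω j) := by
    intro y
    rw [hp, ← Finset.sum_div, ← add_div]
    refine div_le_div_of_nonneg_right ?_ hcard.le
    rw [Finset.sum_comm (s := (Finset.univ : Finset ι)), ← Finset.sum_add_distrib]
    refine Finset.sum_le_sum fun w _ => ?_
    rw [Finset.sum_comm (s := (Finset.univ : Finset ι)), ← Finset.sum_add_distrib]
    refine Finset.sum_le_sum fun m _ => ?_
    rw [← Finset.mul_sum, ← mul_add]
    refine le_mul_of_one_le_right (he0 y w m) ?_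
    have hn : ∀ i ∈ Finset.univ, (0 : ℝ) ≤ if argmax (dec i m w) ≠ y then 1 else 0 :=
      fun i _ => by split_ifs <;> norm_num
    by_cases h : ∀ i, argmax (dec i m w) = y
    · rw [if_pos h]
      linarith [Finset.sum_nonneg hn]
    · rw [if_neg h, zero_add]
      push Not at h
      obtain ⟨i, hi⟩ := h
      have := Finset.single_le_sum hn (Finset.mem_univ i)
      rwa [if_pos hi] at this
  calc _ ≤ ∑ y ∈ G, ((∑ w, f y w) / Fintype.card (∀ j, Ω j) +
        ∑ i, (∑ w, ∑ m, e y w m * (if argmax (dec i m w) ≠ y then 1 else 0)) /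
        Fintype.card (∀ j, Ω j)) := Finset.sum_le_sum fun y _ => hsplit y
    _ = ∑ y ∈ G, (∑ w, f y w) / Fintype.card (∀ j, Ω j) +
        ∑ i, ∑ y ∈ G, (∑ w, ∑ m, e y w m * (if argmax (dec i m w) ≠ y then 1 else 0)) /
        Fintype.card (∀ j, Ω j) := by
        rw [Finset.sum_add_distrib, Finset.sum_comm (s := G)]
    _ ≤ ∑ y ∈ G, (∑ w, f y w) / Fintype.card (∀ j, Ω j) + ∑ i : ι, (1 - ∑ y, p y) := by
        refine add_le_add le_rfl (Finset.sum_le_sum fun i _ => ?_)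
        refine (Finset.sum_le_univ_sum_of_nonneg fun y => ?_).trans (hloss i)
        exact div_nonneg (Finset.sum_nonneg fun w _ => Finset.sum_nonneg fun m _ =>
          mul_nonneg (he0 y w m) (by split_ifs <;> norm_num)) hcard.le
    _ ≤ _ := by
        rw [Finset.sum_const, nsmul_eq_mul, Finset.card_univ]
        linarith

end Converse

/-! ### Sizes of the index sets, and the diagonal target law. -/

section Counts

lemma indexCount_pos (n : ℕ) {r : ℝ} (hr : 0 ≤ r) : 0 < indexCount n r :=
  Nat.floor_pos.2 (Real.one_le_rpow one_le_two (by positivity))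

lemma indexCount_le (n : ℕ) (r : ℝ) : (indexCount n r : ℝ) ≤ 2 ^ (n * r) :=
  Nat.floor_le (by positivity)

lemma rpow_le_two_mul_indexCount (n : ℕ) {r : ℝ} (hr : 0 ≤ r) :
    (2 : ℝ) ^ (n * r) ≤ 2 * indexCount n r := by
  have h1 : (1 : ℝ) ≤ indexCount n r := Nat.one_le_cast.2 (indexCount_pos n hr)
  have h2 : (2 : ℝ) ^ (n * r) < indexCount n r + 1 := Nat.lt_floor_add_one _
  linarith

variable {t : ℕ} {α : Type*}

lemma iidTarget_const (ht : 0 < t) (pX : PMF α) (n : ℕ) (y : Fin n → α) :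
    iidTarget (pX.map fun (a : α) (_ : Fin t) => a) n (fun _ => y) = ∏ k, (pX (y k)).toReal := by
  classical
  have : Nonempty (Fin t) := ⟨⟨0, ht⟩⟩
  refine Finset.prod_congr rfl fun k _ => ?_
  rw [PMF.map_apply, tsum_eq_single (y k)]
  · simp
  · intro a ha
    rw [if_neg]
    intro h
    exact ha (congrFun h ⟨0, ht⟩).symm

lemma iidTarget_eq_zero (pX : PMF α) (n : ℕ) (x : Fin t → Fin n → α)
    (hx : x ∉ Set.range fun (y : Fin n → α) (_ : Fin t) => y) :
    iidTarget (pX.map fun (a : α) (_ : Fin t) => a) n x = 0 := by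
  classical
  by_contra h
  refine hx ?_
  have hk : ∀ k, ∃ a, (fun i => x i k) = fun _ : Fin t => a := by
    intro k
    have h1 := Finset.prod_ne_zero_iff.1 h k (Finset.mem_univ k)
    have h2 : (fun i => x i k) ∈ (pX.map fun (a : α) (_ : Fin t) => a).support := by
      rw [PMF.mem_support_iff]
      intro h0
      simp [h0] at h1
    rw [PMF.mem_support_map_iff] at h2
    obtain ⟨a, _, ha⟩ := h2
    exact ⟨a, ha.symm⟩
  choose y hy using hk
  exact ⟨y, funext fun i => funext fun k => (congrFun (hy k) i).symm⟩

lemma const_injective (ht : 0 < t) {β : Type*} :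
    Function.Injective fun (y : β) (_ : Fin t) => y :=
  fun _ _ h => congrFun h ⟨0, ht⟩

end Counts

/-! ### The converse for block codes and its limit. -/

section ForeheadConverse

variable {t : ℕ} {α : Type*} [Fintype α]

/-- The finite block-length bound of the converse. -/
lemma forehead_block_converse (ht : 2 ≤ t) (pX : PMF α) {n : ℕ} {R : ℝ} {Rs : Fin t → ℝ}
    (hR : 0 ≤ R) (hRs : ∀ j, 0 ≤ Rs j)
    (c : SimulationCode (foreheadAccess t) (fun _ => α) n R Rs) (S : Finset (Fin t))
    (j₀ : Fin t) (hj₀ : j₀ ∉ S) {l : ℝ} (hl : 0 < l) (θ : ℝ) {k : ℕ}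
    (hk : (Sᶜ.erase j₀).card = k) {d τ : ℝ}
    (hd : d = ∑ x : Fin t → Fin n → α,
      |c.induced x - iidTarget (pX.map fun (a : α) (_ : Fin t) => a) n x|)
    (hτ : τ = ∑ y : Fin n → α with (2 : ℝ) ^ (-(n * θ)) < ∏ k, (pX (y k)).toReal,
      ∏ k, (pX (y k)).toReal) :
    1 ≤ (t + 3) * d + τ + k / l + 2 * l ^ k *
      ((2 : ℝ) ^ ((k + 1) * R + ∑ j ∈ S, Rs j - θ)) ^ n := by
  classical
  have ht0 : 0 < t := by omega
  have : Nontrivial (Fin t) := Fin.nontrivial_iff_two_le.2 ht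
  have : Nonempty α := ⟨pX.support_nonempty.some⟩
  have hN : ∀ j, Nonempty (Fin (indexCount n (Rs j))) := fun j =>
    ⟨⟨0, indexCount_pos n (hRs j)⟩⟩
  have hM : Nonempty (Fin (indexCount n R)) := ⟨⟨0, indexCount_pos n hR⟩⟩
  set p : (Fin n → α) → ℝ := fun y => c.induced fun _ => y with hp
  set q : (Fin n → α) → ℝ := fun y => ∏ k, (pX (y k)).toReal with hq
  have hq0 : ∀ y, 0 ≤ q y := fun y => Finset.prod_nonneg fun _ _ => ENNReal.toReal_nonneg
  have hq1 : ∑ y, q y = 1 := sum_prod_eq_one pX.sum_toReal_eq_one n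
  have hdl : ∑ y, |p y - q y| ≤ d := by
    calc _ = ∑ y : Fin n → α, |c.induced (fun _ => y) -
          iidTarget (pX.map fun (a : α) (_ : Fin t) => a) n fun _ => y| :=
          Finset.sum_congr rfl fun y _ => by rw [iidTarget_const ht0]
      _ = ∑ x ∈ Finset.univ.image fun (y : Fin n → α) (_ : Fin t) => y,
          |c.induced x - iidTarget (pX.map fun (a : α) (_ : Fin t) => a) n x| :=
          (Finset.sum_image (f := fun x => |c.induced x - _|) (const_injective ht0).injOn).symm
      _ ≤ _ := hd ▸ Finset.sum_le_univ_sum_of_nonneg fun x => abs_nonneg _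
  have hpform : ∀ y, p y = (∑ w, ∑ m, (c.encoder w m).toReal *
      ∏ i, (c.decoder i m (fun j : {j : Fin t // j ∈ foreheadAccess t i} => w j.1) y).toReal) /
        Fintype.card (∀ j, Fin (indexCount n (Rs j))) := by
    intro y
    simp only [hp, SimulationCode.induced, SimulationCode.joint, Fintype.card_pi, Fintype.card_fin,
      Nat.cast_prod, div_eq_inv_mul, Finset.mul_sum, Finset.prod_inv_distrib, mul_assoc]
  -- The factor `2` serves `hcompl`: if `p y > K` but `q y ≤ 2 ^ (-(n * θ))`, then `p y > 2 * q y`,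
  -- so `p y` is at most `2 * |p y - q y|`.
  set K : ℝ := 2 * 2 ^ (-(n * θ)) with hK
  have hK0 : 0 ≤ K := by positivity
  set G := Finset.univ.filter fun y => p y ≤ K with hG
  have hshot := forehead_one_shot_converse (fun w m => (c.encoder w m).toReal)
    (fun i m (w : ∀ j, Fin (indexCount n (Rs j))) y =>
      (c.decoder i m (fun j : {j : Fin t // j ∈ foreheadAccess t i} => w j.1) y).toReal)
    (fun _ _ => ENNReal.toReal_nonneg) (fun w => PMF.sum_toReal_eq_one _)
    (fun _ _ _ _ => ENNReal.toReal_nonneg) (fun i m w => PMF.sum_toReal_eq_one _)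
    (by
      intro i m w a
      have : (fun j : {j : Fin t // j ∈ foreheadAccess t i} => Function.update w i a j.1) =
          fun j : {j : Fin t // j ∈ foreheadAccess t i} => w j.1 := by
        funext j
        have := j.2
        simp only [foreheadAccess, Finset.mem_sdiff, Finset.mem_singleton] at this
        rw [Function.update_of_ne this.2]
      rw [this])
    p hpform S j₀ hj₀ hl hK0 G (fun y hy => (Finset.mem_filter.1 hy).2)
  simp only [Fintype.card_fin, hk] at hshot
  have hp1 : 1 - d ≤ ∑ y, p y := by
    have h1 : ∑ y, q y - ∑ y, p y ≤ ∑ y, |p y - q y| := by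
      rw [← Finset.sum_sub_distrib]
      refine Finset.sum_le_sum fun y _ => ?_
      rw [abs_sub_comm]
      exact le_abs_self _
    linarith
  have hcompl : ∑ y ∈ Gᶜ, p y ≤ τ + 2 * d := by
    calc _ ≤ ∑ y ∈ Gᶜ, ((if (2 : ℝ) ^ (-(n * θ)) < q y then q y else 0) + 2 * |p y - q y|) := by
          refine Finset.sum_le_sum fun y hy => ?_
          have hy' : K < p y := by simpa [hG] using hy
          have h1 := le_abs_self (p y - q y)
          split_ifs with h
          · linarith [abs_nonneg (p y - q y)]
          · rw [hK] at hy'; linarith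
      _ ≤ ∑ y, ((if (2 : ℝ) ^ (-(n * θ)) < q y then q y else 0) + 2 * |p y - q y|) := by
          refine Finset.sum_le_univ_sum_of_nonneg fun y => add_nonneg ?_ (by positivity)
          split_ifs
          exacts [hq0 y, le_rfl]
      _ ≤ _ := by
          rw [Finset.sum_add_distrib, ← Finset.mul_sum, ← Finset.sum_filter, hτ]
          linarith
  have hGsum := Finset.sum_add_sum_compl G p
  have hpow : (indexCount n R : ℝ) * ((l * indexCount n R) ^ k *
      ((∏ j ∈ S, (indexCount n (Rs j) : ℝ)) * K)) ≤
      2 * l ^ k * ((2 : ℝ) ^ ((k + 1) * R + ∑ j ∈ S, Rs j - θ)) ^ n := by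
    have h1 : (indexCount n R : ℝ) ^ (k + 1) ≤ 2 ^ (n * R * (k + 1)) := by
      refine (pow_le_pow_left₀ (Nat.cast_nonneg _) (indexCount_le n R) _).trans_eq ?_
      rw [← Real.rpow_mul_natCast two_pos.le]
      push_cast; rfl
    have h2 : ∏ j ∈ S, (indexCount n (Rs j) : ℝ) ≤ 2 ^ (∑ j ∈ S, n * Rs j) := by
      rw [Real.rpow_sum_of_pos two_pos]
      exact Finset.prod_le_prod (fun _ _ => Nat.cast_nonneg _) fun j _ => indexCount_le n (Rs j)
    calc _ = 2 * l ^ k * ((indexCount n R : ℝ) ^ (k + 1) *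
          (∏ j ∈ S, (indexCount n (Rs j) : ℝ)) * 2 ^ (-(n * θ))) := by
          rw [hK, mul_pow]; ring
      _ ≤ 2 * l ^ k * (2 ^ (n * R * (k + 1)) * 2 ^ (∑ j ∈ S, n * Rs j) * 2 ^ (-(n * θ))) := by
          gcongr
      _ = _ := by
          rw [← Real.rpow_add two_pos, ← Real.rpow_add two_pos, ← Real.rpow_mul_natCast two_pos.le,
            ← Finset.mul_sum]
          congr 2
          ring
  -- The coefficient `t + 3` of `d` collects `t` from the restriction to modes, `2` from the words
  -- outside `G` and `1` from the mass of `p` off the diagonal.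
  have htd : (t : ℝ) * (1 - ∑ y, p y) ≤ t * d :=
    mul_le_mul_of_nonneg_left (by linarith) (Nat.cast_nonneg _)
  linarith

/-- The converse part of the coding theorem for randomness on the forehead. -/
lemma entropy_le_of_achievable (ht : 2 ≤ t) (pX : PMF α) (r : ℝ × (Fin t → ℝ))
    (hr : Achievable (foreheadAccess t) (pX.map fun (a : α) (_ : Fin t) => a) r)
    (i : ℕ) (hi : 1 ≤ i) (hit : i ≤ t) (S : Finset (Fin t)) (hS : S.card = t - i) :
    shannonEntropy pX ≤ (i : ℝ) * r.1 + ∑ j ∈ S, r.2 j := by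
  obtain ⟨hR, hRs, c, hc⟩ := hr
  by_contra hlt
  push Not at hlt
  obtain ⟨θ, hθ1, hθ2⟩ := exists_between hlt
  have hcompl : Sᶜ.card = i := by rw [Finset.card_compl, Fintype.card_fin, hS]; omega
  obtain ⟨j₀, hj₀⟩ : Sᶜ.Nonempty := Finset.card_pos.1 (by omega)
  obtain ⟨k, rfl⟩ : ∃ k, i = k + 1 := ⟨i - 1, by omega⟩
  have hk : (Sᶜ.erase j₀).card = k := by rw [Finset.card_erase_of_mem hj₀, hcompl]; omega
  -- With `l = 2 * (k + 1)`, independent of `n`, the only term that survives the limit is `k / l <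
  -- 1`, which contradicts the lower bound `1`.
  have hl : (0 : ℝ) < 2 * (k + 1) := by positivity
  have hbound := fun n => forehead_block_converse ht pX hR hRs (c n) S j₀
    (Finset.mem_compl.1 hj₀) hl θ hk rfl rfl
  have hb : (2 : ℝ) ^ ((k + 1) * r.1 + ∑ j ∈ S, r.2 j - θ) < 1 := by
    refine Real.rpow_lt_one_of_one_lt_of_neg one_lt_two ?_
    push_cast at hθ1
    linarith
  have hlim := (((hc.const_mul ((t : ℝ) + 3)).add
    (tendsto_sum_prod_gt_two_rpow pX θ hθ2)).add_const ((k : ℝ) / (2 * (k + 1)))).add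
    ((tendsto_pow_atTop_nhds_zero_of_lt_one (by positivity) hb).const_mul
      (2 * (2 * ((k : ℝ) + 1)) ^ k))
  have h := ge_of_tendsto' hlim hbound
  have h2 : (k : ℝ) / (2 * (k + 1)) < 1 := by
    rw [div_lt_one hl]; linarith [(Nat.cast_nonneg k : (0 : ℝ) ≤ k)]
  simp only [mul_zero, zero_add, add_zero] at h
  linarith

end ForeheadConverse

/-! ### Achievability by the modular-sum code. -/

section Achievability

/-- Every residue class modulo `a` contains about `N / a` of the first `N` natural numbers. -/
lemma card_fin_cast_eq_mul_min_le {N : ℕ} (hN : 0 < N) {a : ℕ} (u : ZMod a) :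
    (Finset.univ.filter fun k : Fin N => ((k : ℕ) : ZMod a) = u).card * min a N ≤ 2 * N := by
  have h : (Finset.univ.filter fun k : Fin N => ((k : ℕ) : ZMod a) = u).card ≤
      (Finset.range ((N - 1) / a + 1)).card := by
    refine Finset.card_le_card_of_injOn (fun k => (k : ℕ) / a) (fun k _ => ?_) ?_
    · simp only [Finset.coe_range, Set.mem_Iio]
      have := Nat.div_le_div_right (c := a) (show (k : ℕ) ≤ N - 1 by omega)
      omega
    · intro k hk k' hk' hkk
      simp only [Finset.coe_filter, Finset.mem_univ, true_and, Set.mem_ofPred_eq] at hk hk'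
      have hmod : (k : ℕ) % a = (k' : ℕ) % a :=
        (ZMod.natCast_eq_natCast_iff _ _ _).1 (hk.trans hk'.symm)
      have h1 := Nat.div_add_mod (k : ℕ) a
      have h2 := Nat.div_add_mod (k' : ℕ) a
      simp only at hkk
      rw [hmod, hkk, h2] at h1
      exact Fin.ext h1.symm
  rw [Finset.card_range] at h
  rcases le_total a N with haN | haN
  · rw [min_eq_left haN]
    have h1 := Nat.div_mul_le_self (N - 1) a
    calc _ ≤ ((N - 1) / a + 1) * a := Nat.mul_le_mul_right a h
      _ ≤ 2 * N := by rw [add_mul]; omega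
  · rw [min_eq_right haN]
    rw [Nat.div_eq_of_lt (by omega)] at h
    nlinarith

lemma sum_map_uniform_mul {E M : Type*} [Fintype E] [Nonempty E] [Fintype M] (φ : E → M)
    (F : M → ℝ) :
    ∑ m, (((PMF.uniformOfFintype E).map φ) m).toReal * F m =
      ∑ e, (Fintype.card E : ℝ)⁻¹ * F (φ e) := by
  classical
  have h : ∀ m, (((PMF.uniformOfFintype E).map φ) m).toReal =
      ∑ e, if m = φ e then (Fintype.card E : ℝ)⁻¹ else 0 := by
    intro m
    rw [PMF.map_apply, tsum_fintype, ENNReal.toReal_sum]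
    · refine Finset.sum_congr rfl fun e _ => ?_
      split_ifs <;> simp
    · intro e _
      split_ifs <;> simp
  simp only [h, Finset.sum_mul]
  rw [Finset.sum_comm]
  simp

variable {t : ℕ}

/-- The residues of the sources modulo `a`. -/
def residues (a : ℕ) {N : Fin t → ℕ} (w : ∀ j, Fin (N j)) (j : Fin t) : ZMod a :=
  ((w j : ℕ) : ZMod a)

/-- Processor `i` recovers all the residues from their sum and the residues that it observes. -/
def recoverResidues (a : ℕ) {N : Fin t → ℕ} (i : Fin t) (s : ZMod a)
    (w : ∀ j : {j : Fin t // j ∈ foreheadAccess t i}, Fin (N j.1)) (j : Fin t) : ZMod a :=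
  if h : j ∈ foreheadAccess t i then ((w ⟨j, h⟩ : ℕ) : ZMod a)
  else s - ∑ k, ((w k : ℕ) : ZMod a)

lemma recoverResidues_eq (a : ℕ) {N : Fin t → ℕ} (i : Fin t) (w : ∀ j, Fin (N j)) :
    recoverResidues a i (∑ j, residues a w j)
      (fun j : {j : Fin t // j ∈ foreheadAccess t i} => w j.1) = residues a w := by
  funext j
  unfold recoverResidues
  split_ifs with h
  · rfl
  · have hj : j = i := by
      by_contra hne
      exact h (by simp [foreheadAccess, hne])
    subst hj
    rw [Finset.sum_coe_sort (foreheadAccess t j) (fun k => ((w k : ℕ) : ZMod a)),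
      ← Finset.add_sum_erase _ _ (Finset.mem_univ j)]
    simp only [foreheadAccess, ← Finset.erase_eq]
    simp [residues]

/-- The modular-sum code: the message is the sum of the residues of the sources modulo `a` together
with a fresh uniform index, and all processors apply the function `g` to the residues and the
index. -/
noncomputable def modularSumCode {α : Type*} {n : ℕ} {R : ℝ} {Rs : Fin t → ℝ} (a b : ℕ) [NeZero b]
    (φ : ZMod a × Fin b ↪ Fin (indexCount n R)) (g : (Fin t → ZMod a) × Fin b → Fin n → α) :
    SimulationCode (foreheadAccess t) (fun _ => α) n R Rs where
  encoder w := (PMF.uniformOfFintype (Fin b)).map fun e => φ (∑ j, residues a w j, e)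
  decoder i m w :=
    -- The default pair `(0, 0)` is used only for messages outside the range of `φ`, which are never
    -- sent.
    let s := @Function.invFun _ _ ⟨(0, 0)⟩ φ m
    PMF.pure (g (recoverResidues (N := fun j => indexCount n (Rs j)) a i s.1 w, s.2))

open Classical in
-- Every processor recovers the same seed, so the randomness of the message reduces to the fresh
-- index and the outputs all equal one function of the seed.
lemma modularSumCode_induced {α : Type*} {n : ℕ} {R : ℝ} {Rs : Fin t → ℝ} (a b : ℕ) [NeZero b]
    (φ : ZMod a × Fin b ↪ Fin (indexCount n R)) (g : (Fin t → ZMod a) × Fin b → Fin n → α)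
    (x : Fin t → Fin n → α) :
    (modularSumCode (Rs := Rs) a b φ g).induced x =
      ∑ w : ∀ j, Fin (indexCount n (Rs j)), ∑ e : Fin b,
        (∏ j, (indexCount n (Rs j) : ℝ)⁻¹) * (b : ℝ)⁻¹ *
          if ∀ i, x i = g (residues a w, e) then 1 else 0 := by
  unfold SimulationCode.induced SimulationCode.joint
  refine Finset.sum_congr rfl fun w _ => ?_
  simp only [mul_assoc]
  rw [← Finset.mul_sum, ← Finset.mul_sum]
  congr 1
  simp only [modularSumCode]
  rw [sum_map_uniform_mul, Fintype.card_fin]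
  refine Finset.sum_congr rfl fun e _ => ?_
  congr 1
  have hinv : @Function.invFun _ _ ⟨(0, 0)⟩ φ (φ (∑ j, residues a w j, e)) =
      (∑ j, residues a w j, e) := @Function.leftInverse_invFun _ _ ⟨(0, 0)⟩ φ φ.injective _
  simp only [hinv, recoverResidues_eq, PMF.pure_apply, apply_ite ENNReal.toReal, ENNReal.toReal_one,
    ENNReal.toReal_zero]
  by_cases h : ∀ i, x i = g (residues a w, e)
  · simp [h]
  · rw [if_neg h]
    push Not at h
    obtain ⟨i, hi⟩ := h
    exact Finset.prod_eq_zero (Finset.mem_univ i) (if_neg hi)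

open Classical in
/-- The mass of each value of the residues and the fresh index. -/
lemma residues_mass_le {N : Fin t → ℕ} (hN : ∀ j, 0 < N j) {L : ℕ} (hL : 0 < L) (jm : Fin t)
    (hjm : ∀ j, N j ≤ N jm) {a b : ℕ} (ha : a = min (N jm) L) (hb : b = L / a)
    (v : (Fin t → ZMod a) × Fin b) :
    ∑ w : ∀ j, Fin (N j), ∑ e : Fin b,
      (if (residues a w, e) = v then (∏ j, (N j : ℝ)⁻¹) * (b : ℝ)⁻¹ else 0) ≤
      4 / L * ∏ j ∈ Finset.univ.erase jm, 2 / (min (L : ℝ) (N j)) := by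
  have ha0 : 0 < a := ha ▸ lt_min (hN jm) hL
  have hb0 : 0 < b := hb ▸ Nat.div_pos (ha ▸ min_le_right _ _) ha0
  obtain ⟨u, e₀⟩ := v
  have hset : (Finset.univ.filter fun w : ∀ j, Fin (N j) => residues a w = u) =
      Fintype.piFinset fun j =>
        Finset.univ.filter fun k : Fin (N j) => ((k : ℕ) : ZMod a) = u j := by
    ext w
    simp [residues, funext_iff]
  have h1 : ∑ w : ∀ j, Fin (N j), ∑ e : Fin b, (if (residues a w, e) = (u, e₀) then
        (∏ j, (N j : ℝ)⁻¹) * (b : ℝ)⁻¹ else 0) =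
      (b : ℝ)⁻¹ * ∏ j, ((Finset.univ.filter fun k : Fin (N j) =>
        ((k : ℕ) : ZMod a) = u j).card : ℝ) * (N j : ℝ)⁻¹ := by
    have : ∀ w : ∀ j, Fin (N j), ∑ e : Fin b, (if (residues a w, e) = (u, e₀) then
        (∏ j, (N j : ℝ)⁻¹) * (b : ℝ)⁻¹ else 0) =
        if residues a w = u then (∏ j, (N j : ℝ)⁻¹) * (b : ℝ)⁻¹ else 0 := by
      intro w
      by_cases h : residues a w = u <;> simp [h]
    simp only [this]
    rw [← Finset.sum_filter, Finset.sum_const, nsmul_eq_mul, hset, Fintype.card_piFinset,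
      Finset.prod_mul_distrib]
    push_cast
    ring
  have h2 : ∀ j, ((Finset.univ.filter fun k : Fin (N j) =>
      ((k : ℕ) : ZMod a) = u j).card : ℝ) * (N j : ℝ)⁻¹ ≤ 2 / (min (a : ℝ) (N j)) := by
    intro j
    have := card_fin_cast_eq_mul_min_le (hN j) (u j)
    have hNj : (0 : ℝ) < N j := Nat.cast_pos.2 (hN j)
    rw [← div_eq_mul_inv, div_le_div_iff₀ hNj (lt_min (Nat.cast_pos.2 ha0) hNj)]
    exact_mod_cast this
  -- Source `jm`, reduced modulo `a`, and the index together have `a * b` values. This is at least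
  -- `L / 2`, so rounding in `b = L / a` costs at most a factor `2`.
  have h3 : (b : ℝ)⁻¹ * (2 / a) ≤ 4 / L := by
    have hLab : L ≤ 2 * (a * b) := by
      have h := Nat.div_add_mod L a
      have h' := Nat.mod_lt L ha0
      rw [← hb] at h
      have : a ≤ a * b := Nat.le_mul_of_pos_right a hb0
      omega
    have hLab' : (L : ℝ) ≤ 2 * (a * b) := by exact_mod_cast hLab
    have : (0 : ℝ) < a := Nat.cast_pos.2 ha0
    have : (0 : ℝ) < b := Nat.cast_pos.2 hb0
    rw [inv_mul_eq_div, div_div, div_le_div_iff₀ (by positivity) (Nat.cast_pos.2 hL)]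
    linarith
  rw [h1]
  calc _ ≤ (b : ℝ)⁻¹ * ∏ j, 2 / (min (a : ℝ) (N j)) := by
        refine mul_le_mul_of_nonneg_left (Finset.prod_le_prod (fun j _ => by positivity)
          fun j _ => h2 j) (by positivity)
    _ = (b : ℝ)⁻¹ * (2 / a) * ∏ j ∈ Finset.univ.erase jm, 2 / (min (L : ℝ) (N j)) := by
        rw [← Finset.mul_prod_erase _ _ (Finset.mem_univ jm), ← mul_assoc]
        congr 1
        · rw [min_eq_left (Nat.cast_le.2 (ha ▸ min_le_left _ _))]
        -- Since `N j ≤ N jm`, replacing `a` by `L` does not change the minimum with `N j`.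
        · refine Finset.prod_congr rfl fun j _ => ?_
          rw [ha, Nat.cast_min, min_assoc, min_comm, min_assoc,
            min_eq_left (a := (N j : ℝ)) (Nat.cast_le.2 (hjm j))]
    _ ≤ _ := mul_le_mul_of_nonneg_right h3 (Finset.prod_nonneg fun j _ => by positivity)

variable {α : Type*} [Fintype α]

lemma indexCount_mono (n : ℕ) {r s : ℝ} (h : r ≤ s) : indexCount n r ≤ indexCount n s :=
  Nat.floor_le_floor (Real.rpow_le_rpow_of_exponent_le one_le_two (by gcongr))

/-- The finite block-length bound for achievability. -/
lemma exists_forehead_code (ht : 0 < t) (pX : PMF α) (n : ℕ) {R : ℝ} {Rs : Fin t → ℝ}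
    (hR : 0 ≤ R) (hRs : ∀ j, 0 ≤ Rs j) (jm : Fin t) (hjm : ∀ j, Rs j ≤ Rs jm) (θ : ℝ) :
    ∃ c : SimulationCode (foreheadAccess t) (fun _ => α) n R Rs,
      ∑ x : Fin t → Fin n → α,
        |c.induced x - iidTarget (pX.map fun (a : α) (_ : Fin t) => a) n x| ≤
      2 * (8 * 4 ^ (t - 1) *
        ((2 : ℝ) ^ (θ - (R + ∑ j ∈ Finset.univ.erase jm, min R (Rs j)))) ^ n +
        ∑ y : Fin n → α with ∏ k, (pX (y k)).toReal ≤ (2 : ℝ) ^ (-(n * θ)),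
          ∏ k, (pX (y k)).toReal) := by
  classical
  have : Nonempty α := ⟨pX.support_nonempty.some⟩
  set N : Fin t → ℕ := fun j => indexCount n (Rs j) with hNdef
  set L := indexCount n R with hLdef
  have hN : ∀ j, 0 < N j := fun j => indexCount_pos n (hRs j)
  have hL : 0 < L := indexCount_pos n hR
  set a := min (N jm) L with ha
  set b := L / a with hb
  have ha0 : 0 < a := lt_min (hN jm) hL
  have hb0 : 0 < b := Nat.div_pos (min_le_right _ _) ha0
  have : NeZero a := ⟨ha0.ne'⟩
  have : NeZero b := ⟨hb0.ne'⟩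
  obtain ⟨φ⟩ : Nonempty (ZMod a × Fin b ↪ Fin L) := by
    refine Function.Embedding.nonempty_of_card_le ?_
    rw [Fintype.card_prod, ZMod.card, Fintype.card_fin, Fintype.card_fin]
    exact Nat.mul_div_le L a
  set μ : ℝ := (∏ j, (N j : ℝ)⁻¹) * (b : ℝ)⁻¹ with hμ
  have hμ0 : 0 ≤ μ := by positivity
  set p : (Fin t → ZMod a) × Fin b → ℝ := fun v =>
    ∑ w : ∀ j, Fin (N j), ∑ e : Fin b, if (residues a w, e) = v then μ else 0 with hp
  set η : ℝ := 4 / L * ∏ j ∈ Finset.univ.erase jm, 2 / (min (L : ℝ) (N j)) with hη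
  have hp1 : ∑ v, p v = 1 := by
    simp only [hp]
    rw [Finset.sum_comm (s := (Finset.univ : Finset ((Fin t → ZMod a) × Fin b)))]
    have : ∀ w : ∀ j, Fin (N j), ∑ v : (Fin t → ZMod a) × Fin b, ∑ e : Fin b,
        (if (residues a w, e) = v then μ else 0) = b * μ := by
      intro w
      rw [Finset.sum_comm (s := (Finset.univ : Finset ((Fin t → ZMod a) × Fin b)))]
      simp
    rw [Finset.sum_congr rfl fun w _ => this w]
    simp only [Finset.sum_const, nsmul_eq_mul, Finset.card_univ, Fintype.card_pi,
      Fintype.card_fin, hμ, Nat.cast_prod]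
    have h1 : (∏ j, (N j : ℝ)) * ∏ j, (N j : ℝ)⁻¹ = 1 := by
      rw [← Finset.prod_mul_distrib]
      exact Finset.prod_eq_one fun j _ => mul_inv_cancel₀ (Nat.cast_ne_zero.2 (hN j).ne')
    have h2 : (b : ℝ) * (b : ℝ)⁻¹ = 1 := mul_inv_cancel₀ (Nat.cast_ne_zero.2 hb0.ne')
    calc _ = ((∏ j, (N j : ℝ)) * ∏ j, (N j : ℝ)⁻¹) * ((b : ℝ) * (b : ℝ)⁻¹) := by ring
      _ = 1 := by rw [h1, h2, one_mul]
  set q : (Fin n → α) → ℝ := fun y => ∏ k, (pX (y k)).toReal with hq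
  have hq0 : ∀ y, 0 ≤ q y := fun y => Finset.prod_nonneg fun _ _ => ENNReal.toReal_nonneg
  have hq1 : ∑ y, q y = 1 := sum_prod_eq_one pX.sum_toReal_eq_one n
  obtain ⟨g, hg⟩ := exists_map_l1_le p q (η := η)
    (fun v => Finset.sum_nonneg fun w _ => Finset.sum_nonneg fun e _ => by
      split_ifs
      exacts [hμ0, le_rfl])
    (fun v => residues_mass_le hN hL jm (fun j => indexCount_mono n (hjm j)) ha hb v) hp1 hq0 hq1
  replace hg : ∀ T : Finset (Fin n → α), ∑ y, |(∑ v with g v = y, p v) - q y| ≤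
      2 * (T.card * η + ∑ y ∈ Tᶜ, q y) := fun T => by convert hg T
  refine ⟨modularSumCode a b φ g, ?_⟩
  have hconst : ∀ y : Fin n → α, (modularSumCode (Rs := Rs) a b φ g).induced (fun _ => y) =
      ∑ v with g v = y, p v := by
    intro y
    rw [modularSumCode_induced, Finset.sum_filter]
    have : ∀ v, (if g v = y then p v else 0) = ∑ w : ∀ j, Fin (N j), ∑ e : Fin b,
        if (residues a w, e) = v then (if g v = y then μ else 0) else 0 := by
      intro v
      by_cases h : g v = y <;> simp [h, hp]
    simp only [this]
    rw [Finset.sum_comm (s := (Finset.univ : Finset ((Fin t → ZMod a) × Fin b)))]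
    refine Finset.sum_congr rfl fun w _ => ?_
    rw [Finset.sum_comm (s := (Finset.univ : Finset ((Fin t → ZMod a) × Fin b)))]
    refine Finset.sum_congr rfl fun e _ => ?_
    rw [Finset.sum_ite_eq, if_pos (Finset.mem_univ _)]
    have : Nonempty (Fin t) := ⟨⟨0, ht⟩⟩
    simp only [forall_const, eq_comm (a := y), mul_ite, mul_one, mul_zero]
    rfl
  have hzero : ∀ x : Fin t → Fin n → α,
      x ∉ Set.range (fun (y : Fin n → α) (_ : Fin t) => y) →
      (modularSumCode (Rs := Rs) a b φ g).induced x = 0 := by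
    intro x hx
    rw [modularSumCode_induced]
    refine Finset.sum_eq_zero fun w _ => Finset.sum_eq_zero fun e _ => ?_
    rw [if_neg, mul_zero]
    intro h
    exact hx ⟨_, funext fun i => (h i).symm⟩
  -- Both laws vanish off the diagonal, so the distance is computed over single words.
  rw [← Fintype.sum_of_injective (fun (y : Fin n → α) (_ : Fin t) => y) (const_injective ht)
    (fun y => |(∑ v with g v = y, p v) - q y|) _
    (fun x hx => by rw [hzero x hx, iidTarget_eq_zero pX n x hx, sub_zero, abs_zero])
    (fun y => by rw [hconst, iidTarget_const ht])]
  -- `T` is the set of likely words: there are at most `2 ^ (n * θ)` of them, and the others make up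
  -- the second term of the bound.
  refine (hg (Finset.univ.filter fun y => (2 : ℝ) ^ (-(n * θ)) < q y)).trans ?_
  rw [Finset.compl_filter]
  simp only [not_lt]
  refine mul_le_mul_of_nonneg_left (add_le_add ?_ le_rfl) two_pos.le
  have hcard : ((Finset.univ.filter fun y => (2 : ℝ) ^ (-(n * θ)) < q y).card : ℝ) ≤
      2 ^ (n * θ) := by
    refine (card_filter_lt_le q hq0 hq1 (by positivity)).trans_eq ?_
    rw [← Real.rpow_neg two_pos.le, neg_neg]
  have hL2 : 4 / (L : ℝ) ≤ 8 * 2 ^ (-(n * R)) := by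
    rw [Real.rpow_neg two_pos.le, ← div_eq_mul_inv,
      div_le_div_iff₀ (Nat.cast_pos.2 hL) (by positivity)]
    linarith [rpow_le_two_mul_indexCount n hR]
  have hmin : ∀ j, 2 / (min (L : ℝ) (N j)) ≤ 4 * 2 ^ (-(n * min R (Rs j))) := by
    intro j
    have h1 : (2 : ℝ) ^ (n * min R (Rs j)) ≤ 2 * min (L : ℝ) (N j) := by
      rw [mul_min_of_nonneg (L : ℝ) (N j : ℝ) two_pos.le]
      refine le_min ((Real.rpow_le_rpow_of_exponent_le one_le_two ?_).trans
        (rpow_le_two_mul_indexCount n hR)) ((Real.rpow_le_rpow_of_exponent_le one_le_two ?_).trans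
        (rpow_le_two_mul_indexCount n (hRs j)))
      · exact mul_le_mul_of_nonneg_left (min_le_left _ _) (Nat.cast_nonneg _)
      · exact mul_le_mul_of_nonneg_left (min_le_right _ _) (Nat.cast_nonneg _)
    rw [Real.rpow_neg two_pos.le, ← div_eq_mul_inv,
      div_le_div_iff₀ (lt_min (Nat.cast_pos.2 hL) (Nat.cast_pos.2 (hN j))) (by positivity)]
    linarith
  have hη_le : η ≤ 8 * 2 ^ (-(n * R)) *
      (4 ^ (t - 1) * 2 ^ (∑ j ∈ Finset.univ.erase jm, -(n * min R (Rs j)))) := by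
    refine mul_le_mul hL2 ?_ (Finset.prod_nonneg fun j _ => by positivity) (by positivity)
    refine (Finset.prod_le_prod (fun j _ => by positivity) fun j _ => hmin j).trans_eq ?_
    rw [Finset.prod_mul_distrib, Finset.prod_const, Finset.card_erase_of_mem (Finset.mem_univ _),
      Finset.card_univ, Fintype.card_fin, Real.rpow_sum_of_pos two_pos]
  calc _ ≤ (2 : ℝ) ^ (n * θ) * (8 * 2 ^ (-(n * R)) *
      (4 ^ (t - 1) * 2 ^ (∑ j ∈ Finset.univ.erase jm, -(n * min R (Rs j))))) :=
        mul_le_mul hcard hη_le (by positivity) (by positivity)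
    _ = 8 * 4 ^ (t - 1) * (2 ^ (n * θ) * 2 ^ (-(n * R)) *
        2 ^ (∑ j ∈ Finset.univ.erase jm, -(n * min R (Rs j)))) := by ring
    _ = _ := by
        rw [← Real.rpow_add two_pos, ← Real.rpow_add two_pos, ← Real.rpow_mul_natCast two_pos.le,
          Finset.sum_neg_distrib, ← Finset.mul_sum]
        congr 2
        ring

/-- Rate tuples in the interior of the region are achievable. -/
lemma achievable_of_entropy_lt (pX : PMF α) (R : ℝ) (Rs : Fin t → ℝ) (hR : 0 ≤ R)
    (hRs : ∀ j, 0 ≤ Rs j) (ht : 0 < t)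
    (h : ∀ i : ℕ, 1 ≤ i → i ≤ t → ∀ S : Finset (Fin t), S ⊂ Finset.univ → S.card = t - i →
      shannonEntropy pX < (i : ℝ) * R + ∑ j ∈ S, Rs j) :
    Achievable (foreheadAccess t) (pX.map fun (a : α) (_ : Fin t) => a) (R, Rs) := by
  have : Nonempty (Fin t) := ⟨⟨0, ht⟩⟩
  obtain ⟨jm, hjm⟩ := Finite.exists_max Rs
  have hσ : shannonEntropy pX < R + ∑ j ∈ Finset.univ.erase jm, min R (Rs j) := by
    -- This `S` picks the constraint that evaluates the sum of minima: sources in `S` contribute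
    -- `R_j`, the other sources besides `jm` contribute `R`, and with the leading `R` this gives `t
    -- - |S|` copies of `R`.
    set S := (Finset.univ.erase jm).filter fun j => Rs j < R with hS
    have hjS : jm ∉ S := by simp [hS]
    have hlt : S ⊂ Finset.univ :=
      (Finset.ssubset_univ_iff).2 fun h => hjS (h ▸ Finset.mem_univ jm)
    have hc := Finset.card_lt_card hlt
    rw [Finset.card_univ, Fintype.card_fin] at hc
    refine (h (t - S.card) (by omega) (by omega) S hlt (by omega)).trans_eq ?_
    have hcard : (((Finset.univ.erase jm).filter fun j => ¬ Rs j < R).card : ℝ) =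
        (t - S.card : ℕ) - 1 := by
      have h1 := Finset.card_filter_add_card_filter_not (s := Finset.univ.erase jm)
        (fun j => Rs j < R)
      rw [Finset.card_erase_of_mem (Finset.mem_univ _), Finset.card_univ, Fintype.card_fin,
        ← hS] at h1
      rw [eq_sub_iff_add_eq]
      have h2 : ((Finset.univ.erase jm).filter fun j => ¬ Rs j < R).card + 1 = t - S.card := by
        omega
      exact_mod_cast h2
    rw [← Finset.sum_filter_add_sum_filter_not (Finset.univ.erase jm) (fun j => Rs j < R),
      Finset.sum_congr rfl (s₁ := (Finset.univ.erase jm).filter fun j => Rs j < R) (g := Rs)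
        (fun j hj => min_eq_right (Finset.mem_filter.1 hj).2.le),
      Finset.sum_congr rfl (s₁ := (Finset.univ.erase jm).filter fun j => ¬ Rs j < R)
        (g := fun _ => R) (fun j hj => min_eq_left (not_lt.1 (Finset.mem_filter.1 hj).2)),
      Finset.sum_const, nsmul_eq_mul, hcard, ← hS]
    ring
  obtain ⟨θ, hθ1, hθ2⟩ := exists_between hσ
  refine ⟨hR, hRs, ?_⟩
  choose c hc using fun n => exists_forehead_code ht pX n hR hRs jm hjm θ
  refine ⟨c, squeeze_zero (fun n => Finset.sum_nonneg fun x _ => abs_nonneg _) hc ?_⟩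
  have hb : (2 : ℝ) ^ (θ - (R + ∑ j ∈ Finset.univ.erase jm, min R (Rs j))) < 1 :=
    Real.rpow_lt_one_of_one_lt_of_neg one_lt_two (by linarith)
  simpa using (((tendsto_pow_atTop_nhds_zero_of_lt_one (by positivity) hb).const_mul
    (8 * 4 ^ (t - 1))).add (tendsto_sum_prod_le_two_rpow pX θ hθ1)).const_mul 2

end Achievability

/-! ### The rate region. -/

theorem mainTheorem9 {t : ℕ} (ht : 2 ≤ t) {α : Type*} [Fintype α]
    (q : PMF (Fin t → α)) (pX : PMF α) (hq : q = pX.map (fun (a : α) (_ : Fin t) => a)) :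
    foreheadRegion q =
      {r : ℝ × (Fin t → ℝ) | 0 ≤ r.1 ∧ (∀ j, 0 ≤ r.2 j) ∧
        ∀ i : ℕ, 1 ≤ i → i ≤ t → ∀ S : Finset (Fin t), S ⊂ Finset.univ → S.card = t - i →
          shannonEntropy pX ≤ (i : ℝ) * r.1 + ∑ j ∈ S, r.2 j} := by
  subst hq
  refine Set.Subset.antisymm (closure_minimal ?_ ?_) ?_
  · intro r hr
    exact ⟨hr.1, hr.2.1, fun i hi hit S _ hS => entropy_le_of_achievable ht pX r hr i hi hit S hS⟩
  · simp only [Set.ofPred_and, Set.ofPred_forall]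
    refine (isClosed_le (by fun_prop) (by fun_prop)).inter ((isClosed_iInter fun j =>
      isClosed_le (by fun_prop) (by fun_prop)).inter (isClosed_iInter fun i => isClosed_iInter
      fun _ => isClosed_iInter fun _ => isClosed_iInter fun S => isClosed_iInter fun _ =>
      isClosed_iInter fun _ => isClosed_le (by fun_prop) (by fun_prop)))
  · rintro ⟨R, Rs⟩ ⟨hR, hRs, h⟩
    -- Raising every rate by `ε` makes all constraints strict, because `R` enters each with
    -- coefficient `i ≥ 1`; the closure then absorbs `ε`.
    have hlim : Tendsto (fun ε : ℝ => (R + ε, fun j => Rs j + ε)) (𝓝[>] 0) (𝓝 (R, Rs)) := by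
      have hcont : Continuous fun ε : ℝ => (R + ε, fun j => Rs j + ε) := by fun_prop
      have := hcont.tendsto 0
      simp only [add_zero] at this
      exact this.mono_left nhdsWithin_le_nhds
    refine mem_closure_of_tendsto hlim ?_
    filter_upwards [self_mem_nhdsWithin] with ε hε
    have hε0 : (0 : ℝ) < ε := hε
    refine achievable_of_entropy_lt pX _ _ (by simp only at hR; linarith)
      (fun j => add_nonneg (hRs j) hε0.le) (by omega) fun i hi hit S hSu hS => ?_
    refine (h i hi hit S hSu hS).trans_lt ?_
    have hi' : (1 : ℝ) ≤ i := by exact_mod_cast hi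
    refine add_lt_add_of_lt_of_le (mul_lt_mul_of_pos_left (by simpa using hε0) (by linarith))
      (Finset.sum_le_sum fun j _ => by simpa using hε0.le)
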